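/- Let $n\ge 1$. A map $R:\mathbb R^n\to\mathbb Z^n$ is a quantizer if $R(u+z)=R(u)+z$ for all $u\in\mathbb R^n$, $z\in\mathbb Z^n$, and $R^{-1}(0)$ is Jordan measurable (bounded, with Lebesgue-null boundary). Call a real matrix $\Lambda$ with $n$ columns nonresonant if its rows together with the rows of the identity matrix $I_n$ are linearly independent over $\mathbb Q$, and call a nonsingular $L\in\mathbb R^{n\times n}$ iteratively nonresonant if every submatrix consisting of finitely many distinct rows of the infinite matrix obtained by stacking all nonzero integer powers $\dots,L^{-2},L^{-1},L,L^2,\dots$ is nonresonant. For $\Lambda\in\mathbb R^{m\times n}$ let $\mathcal Q_m(\Lambda)$ be the algebra of all sets $\{x\in\mathbb Z^n:\Lambda x\in G+\mathbb Z^m\}$ with $G\subset[0,1)^m$ Jordan measurable, and let $\mathcal Q_N^-:=\mathcal Q_{Nn}(\Lambda)$, where $\Lambda$ is obtained by stacking $L^{-N},\dots,L^{-1}$. For a nonempty finite $P\subset\mathbb Z^n$ let $W(f,P):=\frac1{\#P}\sum_{x\in P}f(x)$, and for $N\geq 1$ let $\mathcal P_N$ be the class of boxes $\{x\in\mathbb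 Z^n:a_k\le x_k<a_k+\ell_k,\ 1\le k\le n\}$ with $a,\ell\in\mathbb Z^n$ and $\min_k\ell_k\ge N$. A bounded function $f:\mathbb Z^n\to\mathbb R$ is averageable, with average value $\mathbf A(f)$, if $$\sup_{N\ge1}\inf_{P\in\mathcal P_N}W(f,P)=\inf_{N\ge1}\sup_{P\in\mathcal P_N}W(f,P)=:\mathbf A(f).$$ **Theorem.** Let $R:\mathbb R^n\to\mathbb Z^n$ be a quantizer, let $L\in\mathbb R^{n\times n}$ be iteratively nonresonant, let $T:=R\circ L:\mathbb Z^n\to\mathbb Z^n$, and for $k\ge1$ put $T^{-k}(x):=\{y\in\mathbb Z^n:T^k(y)=x\}$. These sets are finite; put $\nu_k(x):=\#T^{-k}(x)$ and $\widetilde\nu_k(x):=|\det L|^k\,\nu_k(x)$. Then $(\widetilde\nu_N)_{N\ge1}$ is a martingale with respect to the filtration $(\mathcal Q_N^-)_{N\ge1}$ in the following sense: for every $N\ge1$, all level sets $\{x\in\mathbb Z^n:\nu_N(x)=j\}$, $j=0,1,2,\dots$, belong to $\mathcal Q_N^-$, and, for every $A\in\mathcal Q_N^-$, the functions $\widetilde\nu_{N+1}\mathcal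 I_A$ and $\widetilde\nu_N\mathcal I_A$ (with $\mathcal I_A$ the indicator function of $A$) are averageable and $$\mathbf A(\widetilde\nu_{N+1}\mathcal I_A)=\mathbf A(\widetilde\nu_N\mathcal I_A).$$ Consequently, for every $k\ge1$, the function $\nu_k$ is averageable and $\mathbf A(\nu_k)=|\det L|^{-k}$. -/

import Mathlib

open MeasureTheory

noncomputable section

namespace QuantizedLinear

/-- The integer vector `x`, regarded as a real vector. -/
def toReal {ι : Type*} (x : ι → ℤ) : ι → ℝ := fun i => (x i : ℝ)

/-! ### Averages of functions on the integer lattice -/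

/-- The discrete parallelepiped `{x : a_k ≤ x_k < a_k + ℓ_k for all k}`. -/
def box {n : ℕ} (a ℓ : Fin n → ℤ) : Finset (Fin n → ℤ) :=
  Fintype.piFinset fun k => Finset.Ico (a k) (a k + ℓ k)

/-- The class of parallelepipeds all of whose edge lengths are at least `N`. -/
def boxes (n N : ℕ) : Set (Finset (Fin n → ℤ)) :=
  {P | ∃ a ℓ : Fin n → ℤ, (∀ k, (N : ℤ) ≤ ℓ k) ∧ P = box a ℓ}

/-- The average of `f` over the finite set `P`. -/
def W {n : ℕ} (f : (Fin n → ℤ) → ℝ) (P : Finset (Fin n → ℤ)) : ℝ :=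
  (1 / (P.card : ℝ)) * ∑ x ∈ P, f x

/-- The lower average value `sup_{N ≥ 1} inf_{P ∈ boxes N} W(f, P)`. -/
def lowerAverage {n : ℕ} (f : (Fin n → ℤ) → ℝ) : EReal :=
  ⨆ N : ℕ, ⨆ _ : 1 ≤ N, ⨅ P ∈ boxes n N, ((W f P : ℝ) : EReal)

/-- The upper average value `inf_{N ≥ 1} sup_{P ∈ boxes N} W(f, P)`. -/
def upperAverage {n : ℕ} (f : (Fin n → ℤ) → ℝ) : EReal :=
  ⨅ N : ℕ, ⨅ _ : 1 ≤ N, ⨆ P ∈ boxes n N, ((W f P : ℝ) : EReal)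

/-- The bounded function `f` is averageable and its average value is `a`. -/
def HasAverage {n : ℕ} (f : (Fin n → ℤ) → ℝ) (a : ℝ) : Prop :=
  (∃ C : ℝ, ∀ x, |f x| ≤ C) ∧ lowerAverage f = (a : EReal) ∧ upperAverage f = (a : EReal)

/-! ### Quasiperiodic sets -/

/-- Jordan measurability: a bounded set whose boundary is Lebesgue-null. -/
def JordanMeasurable {ι : Type*} [Fintype ι] (G : Set (ι → ℝ)) : Prop :=
  Bornology.IsBounded G ∧ volume (frontier G) = 0

/-- The set of all lattice points `x` with `Λ x ∈ G + ℤ^m`. -/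
def quasiperiodicSet {ι : Type*} {n : ℕ} (G : Set (ι → ℝ)) (Λ : Matrix ι (Fin n) ℝ) :
    Set (Fin n → ℤ) :=
  {x | ∃ g ∈ G, ∃ z : ι → ℤ, Λ.mulVec (toReal x) = g + toReal z}

/-- The algebra of `Λ`-quasiperiodic sets: those given by Jordan measurable `G ⊆ [0,1)^m`. -/
def quasiperiodicAlgebra {ι : Type*} [Fintype ι] {n : ℕ} (Λ : Matrix ι (Fin n) ℝ) :
    Set (Set (Fin n → ℤ)) :=
  {A | ∃ G : Set (ι → ℝ), G ⊆ Set.univ.pi (fun _ => Set.Ico (0 : ℝ) 1) ∧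
    JordanMeasurable G ∧ A = quasiperiodicSet G Λ}

/-! ### Nonresonance -/

/-- The rows of the identity matrix together with the rows of `Λ` are linearly independent over
the rationals. -/
def Nonresonant {ι : Type*} {n : ℕ} (Λ : Matrix ι (Fin n) ℝ) : Prop :=
  LinearIndependent ℚ (Matrix.fromRows (1 : Matrix (Fin n) (Fin n) ℝ) Λ).row

/-- A matrix with an arbitrary set of rows is nonresonant if all its submatrices, formed by
finitely many distinct rows, are nonresonant. -/
def InfNonresonant {κ : Type*} {n : ℕ} (Λ : Matrix κ (Fin n) ℝ) : Prop :=
  ∀ (m : ℕ) (r : Fin m → κ), Function.Injective r → Nonresonant (Λ.submatrix r id)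

/-- All nonzero integer powers of `L` stacked underneath each other; the row with index `(k, i)`
is the `i`-th row of `L ^ k`. -/
def stackedPowers {n : ℕ} (L : Matrix (Fin n) (Fin n) ℝ) :
    Matrix ({k : ℤ // k ≠ 0} × Fin n) (Fin n) ℝ :=
  Matrix.of fun p j => (L ^ (p.1 : ℤ)) p.2 j

/-- `L` is nonsingular and its stacked nonzero integer powers form a nonresonant matrix. -/
def IterativelyNonresonant {n : ℕ} (L : Matrix (Fin n) (Fin n) ℝ) : Prop :=
  L.det ≠ 0 ∧ InfNonresonant (stackedPowers L)

/-! ### Quantized linear systems -/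

/-- A quantizer: a map commuting with integer translations, with Jordan measurable cell
`R⁻¹(0)`. -/
def IsQuantizer {n : ℕ} (R : (Fin n → ℝ) → (Fin n → ℤ)) : Prop :=
  (∀ (u : Fin n → ℝ) (z : Fin n → ℤ), R (u + toReal z) = R u + z) ∧
    JordanMeasurable (R ⁻¹' {0})

/-- The transition operator `T = R ∘ L` on the lattice. -/
def transition {n : ℕ} (R : (Fin n → ℝ) → (Fin n → ℤ)) (L : Matrix (Fin n) (Fin n) ℝ)
    (x : Fin n → ℤ) : Fin n → ℤ :=
  R (L.mulVec (toReal x))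

/-- The preimage `T^{-k}(x) = {y : T^k y = x}`. -/
def preimageSet {n : ℕ} (R : (Fin n → ℝ) → (Fin n → ℤ)) (L : Matrix (Fin n) (Fin n) ℝ)
    (k : ℕ) (x : Fin n → ℤ) : Set (Fin n → ℤ) :=
  {y | (transition R L)^[k] y = x}

/-- The cardinality `ν_k(x) = #T^{-k}(x)`. -/
def preimageCard {n : ℕ} (R : (Fin n → ℝ) → (Fin n → ℤ)) (L : Matrix (Fin n) (Fin n) ℝ)
    (k : ℕ) (x : Fin n → ℤ) : ℕ :=
  (preimageSet R L k x).ncard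

/-- The rescaled cardinality `|det L|^k · #T^{-k}(x)`. -/
def rescaledCard {n : ℕ} (R : (Fin n → ℝ) → (Fin n → ℤ)) (L : Matrix (Fin n) (Fin n) ℝ)
    (k : ℕ) (x : Fin n → ℤ) : ℝ :=
  |L.det| ^ k * (preimageCard R L k x : ℝ)

/-- The matrix formed by stacking `L^{-1}, …, L^{-N}`; the order of the blocks does not affect
the algebra of quasiperiodic sets. -/
def backwardMatrix {n : ℕ} (L : Matrix (Fin n) (Fin n) ℝ) (N : ℕ) :
    Matrix (Fin N × Fin n) (Fin n) ℝ :=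
  Matrix.of fun p j => (L ^ (-((p.1 : ℤ) + 1))) p.2 j

/-- The algebra `Q_N^-` of quasiperiodic sets generated by `L^{-1}, …, L^{-N}`. -/
def backwardAlgebra {n : ℕ} (L : Matrix (Fin n) (Fin n) ℝ) (N : ℕ) :
    Set (Set (Fin n → ℤ)) :=
  quasiperiodicAlgebra (backwardMatrix L N)

end QuantizedLinear

end

noncomputable section

namespace QuantizedLinear

open Filter Topology

/-! Every element of `T^{-k}(x)` is written as `z + ⌊L⁻ᵏ x⌋` with an integer offset `z`. Since `R`
commutes with integer translations, `T` sends `z + ⌊L⁻ᵏ⁻¹ x⌋` to `z' + ⌊L⁻ᵏ x⌋` exactly when `R({L⁻ᵏ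
x} + L(z - {L⁻ᵏ⁻¹ x})) = z'` (`transition_add_backwardFloor`). This condition involves only
fractional parts, and boundedness of the cell leaves finitely many offsets. By induction `ν_k` is
therefore a finite sum of indicators of sets in `Q_k^-`, whence finiteness and the claim on level
sets.

Averages come from Weyl equidistribution (`Nonresonant.tendsto_W_indicator`): under nonresonance,
the quasiperiodic set given by a Jordan set `G` in the unit cube has frequency `vol G` along large
boxes.

The martingale identity is then a volume computation (`tsum_volume_offsetCell`). Fix the blocks `t`
belonging to `L⁻¹, …, L⁻ᵏ`; the new block `s` ranges over the unit cube. Summing over `z` the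
volumes of `{s : R(lastBlock t + L(z - s)) = z'}` glues translated pieces of the cube into all of
`ℝⁿ`, giving the volume of an affine preimage of a cell. This is `|det L|⁻¹`, whatever `t` and `z'`
are, because a cell has volume 1. So on any `A ∈ Q_k^-` passing from `ν_k` to `ν_{k+1}` multiplies
the average by `|det L|⁻¹`; starting from `ν_0 = 1` this also yields the average of `ν_k`. -/

/-! ### The filter of large boxes -/

/-- The filter on finite sets of lattice points generated by the classes `boxes n N`. -/
def boxFilter (n : ℕ) : Filter (Finset (Fin n → ℤ)) := ⨅ N : ℕ, 𝓟 (boxes n N)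

theorem boxes_antitone {n M N : ℕ} (h : M ≤ N) : boxes n N ⊆ boxes n M := by
  rintro P ⟨a, ℓ, hℓ, rfl⟩
  exact ⟨a, ℓ, fun k => le_trans (by exact_mod_cast h) (hℓ k), rfl⟩

theorem hasBasis_boxFilter (n : ℕ) :
    (boxFilter n).HasBasis (fun N : ℕ => 1 ≤ N) (fun N => boxes n N) := by
  have h : (boxFilter n).HasBasis (fun _ : ℕ => True) (fun N => boxes n N) :=
    hasBasis_iInf_principal fun M N =>
      ⟨max M N, boxes_antitone (le_max_left _ _), boxes_antitone (le_max_right _ _)⟩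
  exact h.to_hasBasis (fun N _ => ⟨N + 1, by omega, boxes_antitone (by omega)⟩)
    (fun N _ => ⟨N, trivial, subset_rfl⟩)

instance boxFilter_neBot (n : ℕ) : (boxFilter n).NeBot :=
  (hasBasis_boxFilter n).neBot_iff.2 fun {N} _ => ⟨_, 0, fun _ => (N : ℤ), fun _ => le_rfl, rfl⟩

theorem nonempty_of_mem_boxes {n N : ℕ} (hN : 1 ≤ N) {P : Finset (Fin n → ℤ)}
    (hP : P ∈ boxes n N) : P.Nonempty := by
  obtain ⟨a, ℓ, hℓ, rfl⟩ := hP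
  refine ⟨a, Fintype.mem_piFinset.2 fun k => Finset.mem_Ico.2 ⟨le_rfl, ?_⟩⟩
  have := hℓ k
  omega

theorem eventually_nonempty (n : ℕ) : ∀ᶠ P in boxFilter n, P.Nonempty :=
  mem_of_superset ((hasBasis_boxFilter n).mem_of_mem le_rfl)
    fun _ hP => nonempty_of_mem_boxes le_rfl hP

/-- The lower and upper averages are the liminf and limsup along `boxFilter`, so averageability of a
bounded function reduces to an ordinary limit. -/
theorem HasAverage.of_tendsto {n : ℕ} {f : (Fin n → ℤ) → ℝ} {a : ℝ}
    (hb : ∃ C : ℝ, ∀ x, |f x| ≤ C) (h : Tendsto (W f) (boxFilter n) (𝓝 a)) :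
    HasAverage f a := by
  have h' : Tendsto (fun P => ((W f P : ℝ) : EReal)) (boxFilter n) (𝓝 (a : EReal)) :=
    (continuous_coe_real_ereal.tendsto a).comp h
  exact ⟨hb, (hasBasis_boxFilter n).liminf_eq_iSup_iInf.symm.trans h'.liminf_eq,
    (hasBasis_boxFilter n).limsup_eq_iInf_iSup.symm.trans h'.limsup_eq⟩

theorem W_sum {n : ℕ} {ι : Type*} (s : Finset ι) (f : ι → (Fin n → ℤ) → ℝ)
    (P : Finset (Fin n → ℤ)) : W (fun x => ∑ i ∈ s, f i x) P = ∑ i ∈ s, W (f i) P := by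
  simp only [W]
  rw [Finset.sum_comm, Finset.mul_sum]

theorem W_const_mul {n : ℕ} (c : ℝ) (f : (Fin n → ℤ) → ℝ) (P : Finset (Fin n → ℤ)) :
    W (fun x => c * f x) P = c * W f P := by
  simp only [W, ← Finset.mul_sum]
  ring

/-! ### Exponential sums over boxes -/

theorem sub_one_mul_sum_zpow {w : ℂ} (hw : w ≠ 0) (a : ℤ) (m : ℕ) :
    (w - 1) * ∑ x ∈ Finset.Ico a (a + m), w ^ x = w ^ (a + m) - w ^ a := by
  induction m with
  | zero => simp
  | succ m ih =>
    have h : Finset.Ico a (a + (m + 1 : ℕ)) = insert (a + m) (Finset.Ico a (a + m)) := by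
      ext x
      simp only [Finset.mem_Ico, Finset.mem_insert]
      omega
    rw [h, Finset.sum_insert (by simp), mul_add, ih]
    push_cast
    rw [← add_assoc, zpow_add_one₀ hw]
    ring

theorem norm_sum_zpow_le {w : ℂ} (hw : ‖w‖ = 1) (hw1 : w ≠ 1) (a : ℤ) (m : ℕ) :
    ‖∑ x ∈ Finset.Ico a (a + m), w ^ x‖ ≤ 2 / ‖w - 1‖ := by
  have h0 : w ≠ 0 := by
    rintro rfl
    simp at hw
  have h1 : 0 < ‖w - 1‖ := norm_pos_iff.2 (sub_ne_zero.2 hw1)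
  rw [le_div_iff₀ h1, mul_comm, ← norm_mul, sub_one_mul_sum_zpow h0]
  refine (norm_sub_le _ _).trans ?_
  rw [norm_zpow, norm_zpow, hw, one_zpow, one_zpow]
  norm_num

theorem norm_sum_zpow_le_card {w : ℂ} (hw : ‖w‖ = 1) (a : ℤ) (m : ℕ) :
    ‖∑ x ∈ Finset.Ico a (a + m), w ^ x‖ ≤ m := by
  refine (norm_sum_le _ _).trans ?_
  simp [norm_zpow, hw]

/-- The character sum factors over the coordinates. The geometric sum in direction `j₀` is bounded
independently of its length, and the other averaged factors have norm at most 1. The bound does not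
see the position of the box. -/
theorem norm_box_average_le {n N : ℕ} (hN : 1 ≤ N) {w : Fin n → ℂ} (hw : ∀ j, ‖w j‖ = 1)
    {j₀ : Fin n} (hj : w j₀ ≠ 1) {P : Finset (Fin n → ℤ)} (hP : P ∈ boxes n N) :
    ‖(P.card : ℂ)⁻¹ * ∑ x ∈ P, ∏ j, w j ^ x j‖ ≤ 2 / ‖w j₀ - 1‖ / N := by
  obtain ⟨a, ℓ, hℓ, rfl⟩ := hP
  obtain ⟨m, rfl⟩ : ∃ m : Fin n → ℕ, ℓ = fun k => (m k : ℤ) :=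
    ⟨fun k => (ℓ k).toNat, funext fun k => (Int.toNat_of_nonneg (by have := hℓ k; omega)).symm⟩
  have hm : ∀ k, N ≤ m k := fun k => Int.ofNat_le.1 (hℓ k)
  have hm0 : ∀ k, (0 : ℝ) < m k := fun k => by exact_mod_cast lt_of_lt_of_le hN (hm k)
  have hc : (box a (fun k => (m k : ℤ))).card = ∏ k, m k := by
    simp [box, Fintype.card_piFinset]
  rw [hc, box, ← Finset.prod_univ_sum (fun k => Finset.Ico (a k) (a k + (m k : ℤ)))
    (fun j x => w j ^ x)]
  push_cast
  rw [← Finset.prod_inv_distrib, ← Finset.prod_mul_distrib, norm_prod,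
    ← Finset.mul_prod_erase _ _ (Finset.mem_univ j₀)]
  have h1 : ∏ x ∈ Finset.univ.erase j₀,
      ‖(m x : ℂ)⁻¹ * ∑ j ∈ Finset.Ico (a x) (a x + (m x : ℤ)), w x ^ j‖ ≤ 1 := by
    refine Finset.prod_le_one (fun _ _ => norm_nonneg _) fun x _ => ?_
    rw [norm_mul, norm_inv, Complex.norm_natCast, inv_mul_le_iff₀ (hm0 x), mul_one]
    exact norm_sum_zpow_le_card (hw x) _ _
  have h2 : ‖(m j₀ : ℂ)⁻¹ * ∑ j ∈ Finset.Ico (a j₀) (a j₀ + (m j₀ : ℤ)), w j₀ ^ j‖ ≤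
      2 / ‖w j₀ - 1‖ / N := by
    rw [norm_mul, norm_inv, Complex.norm_natCast, inv_mul_eq_div]
    have hN' : (0 : ℝ) < N := by exact_mod_cast hN
    have hmN : (N : ℝ) ≤ m j₀ := by exact_mod_cast hm j₀
    exact div_le_div₀ (by positivity) (norm_sum_zpow_le (hw j₀) hj _ _) hN' hmN
  calc _ ≤ 2 / ‖w j₀ - 1‖ / N * 1 :=
        mul_le_mul h2 h1 (Finset.prod_nonneg fun _ _ => norm_nonneg _) (by positivity)
    _ = _ := mul_one _

/-! ### The torus -/

section Torus

variable {ι : Type*}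

/-- The half-open unit cube. -/
def unitCube (ι : Type*) : Set (ι → ℝ) := Set.univ.pi fun _ => Set.Ico (0 : ℝ) 1

/-- The projection of `ℝ^ι` onto the torus. -/
def toTorus (u : ι → ℝ) : UnitAddTorus ι := fun i => (u i : UnitAddCircle)

theorem toTorus_eq_iff {u v : ι → ℝ} : toTorus u = toTorus v ↔ ∃ z : ι → ℤ, u = v + toReal z := by
  simp only [toTorus, funext_iff, Pi.add_apply, toReal]
  rw [← Classical.skolem (p := fun i (z : ℤ) => u i = v i + (z : ℝ))]
  refine forall_congr' fun i => ?_
  rw [← sub_eq_zero, ← AddCircle.coe_sub, AddCircle.coe_eq_zero_iff]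
  refine exists_congr fun z => ?_
  rw [zsmul_eq_mul, mul_one]
  constructor <;> intro h <;> linarith

theorem continuous_toTorus : Continuous (toTorus (ι := ι)) :=
  continuous_pi fun i => (AddCircle.continuous_mk' (1 : ℝ)).comp (continuous_apply i)

theorem mem_quasiperiodicSet_iff {n : ℕ} {G : Set (ι → ℝ)} {Λ : Matrix ι (Fin n) ℝ}
    {x : Fin n → ℤ} :
    x ∈ quasiperiodicSet G Λ ↔ toTorus (Λ.mulVec (toReal x)) ∈ toTorus '' G := by
  simp only [quasiperiodicSet, Set.mem_ofPred_eq, Set.mem_image]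
  exact exists_congr fun g => and_congr_right fun _ => by
    rw [eq_comm (a := toTorus g), toTorus_eq_iff]

theorem isOpenMap_toTorus : IsOpenMap (toTorus (ι := ι)) :=
  IsOpenMap.piMap (fun _ => QuotientAddGroup.isOpenMap_coe)
    (Eventually.of_forall fun _ => QuotientAddGroup.mk_surjective)

theorem toTorus_preimage_image (G : Set (ι → ℝ)) :
    toTorus ⁻¹' (toTorus '' G) = ⋃ z : ι → ℤ, (fun u => u + toReal z) ⁻¹' G := by
  ext u
  simp only [Set.mem_preimage, Set.mem_image, Set.mem_iUnion]
  constructor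
  · rintro ⟨g, hg, h⟩
    obtain ⟨z, rfl⟩ := toTorus_eq_iff.1 h
    exact ⟨z, hg⟩
  · rintro ⟨z, hz⟩
    exact ⟨_, hz, toTorus_eq_iff.2 ⟨z, rfl⟩⟩

/-- `toTorus` is injective on the half-open cube: coordinates of two of its points differ by less
than 1. -/
theorem toTorus_preimage_image_inter {G : Set (ι → ℝ)} (hG : G ⊆ unitCube ι) :
    toTorus ⁻¹' (toTorus '' G) ∩ unitCube ι = G := by
  refine Set.Subset.antisymm ?_ fun u hu => ⟨⟨u, hu, rfl⟩, hG hu⟩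
  rintro u ⟨⟨g, hg, h⟩, hu⟩
  obtain ⟨z, hz⟩ := toTorus_eq_iff.1 h
  have : g = u := by
    ext i
    have h1 : g i = u i + z i := congrFun hz i
    have h2 := hG hg i trivial
    have h3 := hu i trivial
    have h4 : (z i : ℝ) < 1 := by linarith [h2.1, h2.2, h3.1, h3.2]
    have h5 : (-1 : ℝ) < z i := by linarith [h2.1, h2.2, h3.1, h3.2]
    have h6 : z i < 1 := by exact_mod_cast h4
    have h7 : -1 < z i := by exact_mod_cast h5
    have h8 : z i = 0 := by omega
    rw [h1, h8]
    simp
  exact this ▸ hg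

variable [Fintype ι]

theorem measurable_toTorus : Measurable (toTorus (ι := ι)) := continuous_toTorus.measurable

theorem measurableSet_unitCube : MeasurableSet (unitCube ι) :=
  MeasurableSet.univ_pi fun _ => measurableSet_Ico

theorem volume_unitCube : volume (unitCube ι) = 1 := by
  simp [unitCube, volume_pi_pi]

/-- The normalized Lebesgue measure on the torus. -/
def torusMeasure (ι : Type*) [Fintype ι] : Measure (UnitAddTorus ι) :=
  (volume.restrict (unitCube ι)).map toTorus

instance : IsProbabilityMeasure (torusMeasure ι) := by
  have : IsProbabilityMeasure (volume.restrict (unitCube ι)) := ⟨by simp [volume_unitCube]⟩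
  exact Measure.isProbabilityMeasure_map measurable_toTorus.aemeasurable

theorem integral_exp_int_Ico {k : ℤ} (hk : k ≠ 0) :
    ∫ x in Set.Ico (0 : ℝ) 1, (fourier k (x : UnitAddCircle) : ℂ) = 0 := by
  rw [integral_Ico_eq_integral_Ioc, ← intervalIntegral.integral_of_le zero_le_one]
  have h : (2 * Real.pi * Complex.I * k : ℂ) ≠ 0 := by
    simp [Real.pi_ne_zero, hk]
  simp only [fourier_coe_apply, Complex.ofReal_one, div_one]
  rw [integral_exp_mul_complex h]
  have : Complex.exp (2 * Real.pi * Complex.I * k) = 1 := by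
    rw [Complex.exp_eq_one_iff]
    exact ⟨k, by ring⟩
  simp [this]

theorem integral_mFourier_torusMeasure {k : ι → ℤ} (hk : k ≠ 0) :
    ∫ x, UnitAddTorus.mFourier k x ∂torusMeasure ι = 0 := by
  rw [torusMeasure, integral_map measurable_toTorus.aemeasurable
    (UnitAddTorus.mFourier k).continuous.aestronglyMeasurable, unitCube, volume_pi,
    Measure.restrict_pi_pi]
  have h := integral_fintype_prod_eq_prod (fun i (x : ℝ) => (fourier (k i) (x : UnitAddCircle) : ℂ))
    (μ := fun _ : ι => volume.restrict (Set.Ico (0 : ℝ) 1))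
  refine h.trans ?_
  obtain ⟨i, hi⟩ := Function.ne_iff.1 hk
  exact Finset.prod_eq_zero (Finset.mem_univ i) (integral_exp_int_Ico hi)

/-! ### Empirical measures and equidistribution -/

/-- The distribution of `ψ x` for `x` drawn uniformly from `P`. -/
def empiricalMeasure {Ω X : Type*} [MeasurableSpace Ω] (ψ : X → Ω) (P : Finset X) : Measure Ω :=
  (P.card : ENNReal)⁻¹ • ∑ x ∈ P, Measure.dirac (ψ x)

theorem isProbabilityMeasure_empiricalMeasure {Ω X : Type*} [MeasurableSpace Ω] (ψ : X → Ω)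
    {P : Finset X} (hP : P.Nonempty) : IsProbabilityMeasure (empiricalMeasure ψ P) := by
  refine ⟨?_⟩
  simp only [empiricalMeasure, Measure.smul_apply, Measure.finsetSum_apply, measure_univ,
    Finset.sum_const, smul_eq_mul, nsmul_eq_mul, mul_one]
  exact ENNReal.inv_mul_cancel (by simpa using hP.ne_empty) (by simp)

theorem integral_empiricalMeasure {Ω X : Type*} [MeasurableSpace Ω] [MeasurableSingletonClass Ω]
    (ψ : X → Ω) (P : Finset X) (f : Ω → ℂ) :
    ∫ y, f y ∂empiricalMeasure ψ P = (P.card : ℂ)⁻¹ * ∑ x ∈ P, f (ψ x) := by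
  rw [empiricalMeasure, integral_smul_measure, integral_finsetSum_measure]
  · simp
  · intro x _
    exact integrable_dirac (by simp)

theorem empiricalMeasure_apply {Ω X : Type*} [MeasurableSpace Ω] [MeasurableSingletonClass Ω]
    (ψ : X → Ω) (P : Finset X) (E : Set Ω) :
    (empiricalMeasure ψ P E).toReal =
      1 / (P.card : ℝ) * ∑ x ∈ P, (ψ ⁻¹' E).indicator (fun _ => (1 : ℝ)) x := by
  simp only [empiricalMeasure, Measure.smul_apply, Measure.finsetSum_apply, Measure.dirac_apply,
    smul_eq_mul, ENNReal.toReal_mul, ENNReal.toReal_inv, ENNReal.toReal_natCast, one_div]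
  rw [ENNReal.toReal_sum]
  · congr 1
    refine Finset.sum_congr rfl fun x _ => ?_
    by_cases h : ψ x ∈ E <;> simp [h]
  · intro x _
    by_cases h : ψ x ∈ E <;> simp [h]

theorem mFourier_toTorus_mulVec {n : ℕ} (Λ : Matrix ι (Fin n) ℝ) (k : ι → ℤ) (x : Fin n → ℤ) :
    UnitAddTorus.mFourier k (toTorus (Λ.mulVec (toReal x))) =
      ∏ j, Complex.exp (((2 * Real.pi * ∑ i, k i * Λ i j : ℝ) : ℂ) * Complex.I) ^ x j := by
  simp only [UnitAddTorus.mFourier, toTorus, ContinuousMap.coe_mk, fourier_coe_apply,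
    ← Complex.exp_int_mul, ← Complex.exp_sum]
  congr 1
  simp only [Matrix.mulVec, dotProduct, toReal]
  push_cast
  simp only [Finset.mul_sum, Finset.sum_mul, div_one]
  rw [Finset.sum_comm]
  exact Finset.sum_congr rfl fun _ _ => Finset.sum_congr rfl fun _ _ => by ring

/-- If the character `k` were trivial on the orbit, `kΛ` would be an integer row `m`, and `(-m, k)`
would be a rational relation between the rows of the identity and of `Λ`. -/
theorem Nonresonant.exists_exp_ne_one {n : ℕ} {Λ : Matrix ι (Fin n) ℝ} (hΛ : Nonresonant Λ)
    {k : ι → ℤ} (hk : k ≠ 0) :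
    ∃ j, Complex.exp (((2 * Real.pi * ∑ i, k i * Λ i j : ℝ) : ℂ) * Complex.I) ≠ 1 := by
  by_contra! h
  have h' : ∀ j, ∃ m : ℤ, ∑ i, k i * Λ i j = m := fun j => by
    obtain ⟨m, hm⟩ := Complex.exp_eq_one_iff.1 (h j)
    refine ⟨m, ?_⟩
    have h2 : (2 * Real.pi * Complex.I : ℂ) ≠ 0 := by simp [Real.pi_ne_zero]
    have : ((∑ i, k i * Λ i j : ℝ) : ℂ) = (m : ℂ) := by
      apply mul_left_cancel₀ h2
      rw [mul_comm _ (m : ℂ), ← hm]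
      push_cast
      ring
    exact_mod_cast this
  choose m hm using h'
  have := Fintype.linearIndependent_iff.1 hΛ
    (Sum.elim (fun j => -(m j : ℚ)) (fun i => (k i : ℚ))) ?_
  · exact hk (funext fun i => by simpa using this (Sum.inr i))
  · ext j
    simp only [Fintype.sum_sum_type, Sum.elim_inl, Sum.elim_inr, Matrix.row, Finset.sum_apply,
      Pi.smul_apply, Matrix.fromRows_apply_inl, Matrix.fromRows_apply_inr,
      Matrix.one_apply, Pi.zero_apply]
    have := hm j
    simp [Rat.smul_def, this]

theorem tendsto_integral_mFourier {n : ℕ} {Λ : Matrix ι (Fin n) ℝ} (hΛ : Nonresonant Λ)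
    (k : ι → ℤ) :
    Tendsto (fun P => ∫ y, UnitAddTorus.mFourier k y
        ∂empiricalMeasure (fun x => toTorus (Λ.mulVec (toReal x))) P) (boxFilter n)
      (𝓝 (∫ y, UnitAddTorus.mFourier k y ∂torusMeasure ι)) := by
  by_cases hk : k = 0
  · subst hk
    refine tendsto_const_nhds.congr' ?_
    filter_upwards [eventually_nonempty n] with P hP
    have := isProbabilityMeasure_empiricalMeasure
      (fun x : Fin n → ℤ => toTorus (Λ.mulVec (toReal x))) hP
    simp [UnitAddTorus.mFourier_zero]
  · rw [integral_mFourier_torusMeasure hk]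
    obtain ⟨j₀, hj⟩ := hΛ.exists_exp_ne_one hk
    simp only [integral_empiricalMeasure, mFourier_toTorus_mulVec]
    rw [Metric.tendsto_nhds]
    intro ε hε
    obtain ⟨N, hN⟩ :=
      ((tendsto_const_div_atTop_nhds_zero_nat _).eventually_lt_const hε).exists_forall_of_atTop
    refine (hasBasis_boxFilter n).mem_iff.2 ⟨N + 1, by omega, fun P hP => ?_⟩
    have hw : ∀ j, ‖Complex.exp (((2 * Real.pi * ∑ i, k i * Λ i j : ℝ) : ℂ) * Complex.I)‖ = 1 :=
      fun j => Complex.norm_exp_ofReal_mul_I _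
    rw [Set.mem_ofPred_eq, dist_zero_right]
    exact (norm_box_average_le (by omega) hw hj hP).trans_lt
      (hN (N + 1) (by omega))

/-- Trigonometric polynomials are uniformly dense, and integration against a probability measure is
1-Lipschitz in the sup norm; an `ε/3` argument extends the limit from characters. -/
theorem tendsto_integral_continuous {n : ℕ} {Λ : Matrix ι (Fin n) ℝ} (hΛ : Nonresonant Λ)
    (f : C(UnitAddTorus ι, ℂ)) :
    Tendsto (fun P => ∫ y, f y ∂empiricalMeasure (fun x => toTorus (Λ.mulVec (toReal x))) P)
      (boxFilter n) (𝓝 (∫ y, f y ∂torusMeasure ι)) := by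
  set μ : Finset (Fin n → ℤ) → Measure (UnitAddTorus ι) :=
    empiricalMeasure (fun x => toTorus (Λ.mulVec (toReal x)))
  have hprob : ∀ P : Finset (Fin n → ℤ), P.Nonempty → IsProbabilityMeasure (μ P) :=
    fun P hP => isProbabilityMeasure_empiricalMeasure _ hP
  have hint : ∀ (ν : Measure (UnitAddTorus ι)) [IsFiniteMeasure ν] (g : C(UnitAddTorus ι, ℂ)),
      Integrable g ν := fun ν _ g =>
    Integrable.of_bound g.continuous.aestronglyMeasurable ‖g‖
      (ae_of_all _ fun x => g.norm_coe_le_norm x)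
  have hclose : ∀ (ν : Measure (UnitAddTorus ι)) [IsProbabilityMeasure ν]
      (g h : C(UnitAddTorus ι, ℂ)), ‖∫ y, g y ∂ν - ∫ y, h y ∂ν‖ ≤ ‖g - h‖ := fun ν _ g h => by
    rw [← integral_sub (hint ν g) (hint ν h)]
    refine (norm_integral_le_of_norm_le_const (C := ‖g - h‖)
      (ae_of_all _ fun x => (g - h).norm_coe_le_norm x)).trans ?_
    simp
  have hspan : ∀ g ∈ Submodule.span ℂ (Set.range (UnitAddTorus.mFourier (d := ι))),
      Tendsto (fun P => ∫ y, g y ∂μ P) (boxFilter n) (𝓝 (∫ y, g y ∂torusMeasure ι)) := by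
    intro g hg
    induction hg using Submodule.span_induction with
    | mem g hg =>
      obtain ⟨k, rfl⟩ := hg
      exact tendsto_integral_mFourier hΛ k
    | zero => simp
    | add g h _ _ hg hh =>
      simp only [ContinuousMap.add_apply]
      rw [integral_add (hint _ g) (hint _ h)]
      refine (hg.add hh).congr' ?_
      filter_upwards [eventually_nonempty n] with P hP
      have := hprob P hP
      rw [integral_add (hint _ g) (hint _ h)]
    | smul c g _ hg =>
      simp only [ContinuousMap.smul_apply, integral_smul]
      exact hg.const_smul c
  have hf : f ∈ closure (Submodule.span ℂ (Set.range (UnitAddTorus.mFourier (d := ι))) :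
      Set C(UnitAddTorus ι, ℂ)) := by
    rw [← Submodule.topologicalClosure_coe, UnitAddTorus.span_mFourier_closure_eq_top]
    trivial
  rw [Metric.tendsto_nhds]
  intro ε hε
  obtain ⟨g, hg, hfg⟩ := Metric.mem_closure_iff.1 hf (ε / 3) (by positivity)
  rw [dist_eq_norm] at hfg
  filter_upwards [eventually_nonempty n,
    Metric.tendsto_nhds.1 (hspan g hg) (ε / 3) (by positivity)] with P hP hgP
  have := hprob P hP
  have h1 := hclose (μ P) f g
  have h2 := hclose (torusMeasure ι) f g
  rw [← dist_eq_norm] at h1 h2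
  rw [dist_comm] at h2
  calc _ ≤ _ := dist_triangle4 _ (∫ y, g y ∂μ P) (∫ y, g y ∂torusMeasure ι) _
    _ < ε := by linarith

/-- Boundedness makes the image of the closure compact, hence closed; openness of the projection
sends interior points to interior points. -/
theorem frontier_toTorus_image_subset {G : Set (ι → ℝ)} (hG : Bornology.IsBounded G) :
    frontier (toTorus '' G) ⊆ toTorus '' frontier G := by
  have h1 : closure (toTorus '' G) ⊆ toTorus '' closure G :=
    closure_minimal (Set.image_mono subset_closure)
      (hG.isCompact_closure.image continuous_toTorus).isClosed
  have h2 : toTorus '' interior G ⊆ interior (toTorus '' G) :=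
    interior_maximal (Set.image_mono interior_subset) (isOpenMap_toTorus _ isOpen_interior)
  rintro y ⟨hy1, hy2⟩
  obtain ⟨u, hu, rfl⟩ := h1 hy1
  exact ⟨u, ⟨hu, fun hi => hy2 (h2 ⟨u, hi, rfl⟩)⟩, rfl⟩

/-- The preimage of the projected frontier is a countable union of integer translates of a null set.
-/
theorem torusMeasure_frontier_image {G : Set (ι → ℝ)} (hJ : JordanMeasurable G) :
    torusMeasure ι (frontier (toTorus '' G)) = 0 := by
  have hK : IsCompact (frontier G) :=
    hJ.1.isCompact_closure.of_isClosed_subset isClosed_frontier frontier_subset_closure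
  refine measure_mono_null (frontier_toTorus_image_subset hJ.1) ?_
  rw [torusMeasure, Measure.map_apply measurable_toTorus
    (hK.image continuous_toTorus).isClosed.measurableSet]
  refine Measure.absolutelyContinuous_of_le Measure.restrict_le_self ?_
  rw [toTorus_preimage_image]
  exact measure_iUnion_null fun z => by rw [measure_preimage_add_right, hJ.2]

theorem torusMeasure_image {G : Set (ι → ℝ)} (hG : G ⊆ unitCube ι) (hJ : JordanMeasurable G) :
    torusMeasure ι (toTorus '' G) = volume G := by
  rw [torusMeasure, Measure.map_apply₀ measurable_toTorus.aemeasurable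
    (nullMeasurableSet_of_null_frontier (torusMeasure_frontier_image hJ)),
    Measure.restrict_apply₀' measurableSet_unitCube.nullMeasurableSet,
    toTorus_preimage_image_inter hG]

/-- Weyl's equidistribution theorem for quasiperiodic sets. -/
theorem Nonresonant.tendsto_W_indicator {n : ℕ} {Λ : Matrix ι (Fin n) ℝ} (hΛ : Nonresonant Λ)
    {G : Set (ι → ℝ)} (hG : G ⊆ unitCube ι) (hJ : JordanMeasurable G) :
    Tendsto (W ((quasiperiodicSet G Λ).indicator fun _ => (1 : ℝ))) (boxFilter n)
      (𝓝 (volume G).toReal) := by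
  classical
  set ψ : (Fin n → ℤ) → UnitAddTorus ι := fun x => toTorus (Λ.mulVec (toReal x))
  let ν : ProbabilityMeasure (UnitAddTorus ι) := ⟨torusMeasure ι, inferInstance⟩
  have hν : (ν : Measure (UnitAddTorus ι)) = torusMeasure ι := rfl
  -- The value on the empty set is arbitrary, since large boxes are nonempty.
  let μs : Finset (Fin n → ℤ) → ProbabilityMeasure (UnitAddTorus ι) := fun P =>
    if hP : P.Nonempty then
      (⟨empiricalMeasure ψ P, isProbabilityMeasure_empiricalMeasure ψ hP⟩ : ProbabilityMeasure _)
    else ν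
  have hμs : ∀ᶠ P in boxFilter n, (μs P : Measure (UnitAddTorus ι)) = empiricalMeasure ψ P := by
    filter_upwards [eventually_nonempty n] with P hP
    have h : μs P = ⟨empiricalMeasure ψ P, isProbabilityMeasure_empiricalMeasure ψ hP⟩ := dif_pos hP
    rw [h]
    rfl
  have hlim : Tendsto μs (boxFilter n) (𝓝 ν) := by
    rw [ProbabilityMeasure.tendsto_iff_forall_integral_rclike_tendsto ℂ]
    intro f
    refine (tendsto_integral_continuous hΛ f.toContinuousMap).congr' ?_
    filter_upwards [hμs] with P hP
    rw [hP]
    rfl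
  -- Portmanteau: weak convergence passes to sets whose frontier is null for the limit.
  have key := (ENNReal.tendsto_toReal (measure_ne_top _ _)).comp
    (ProbabilityMeasure.tendsto_measure_of_null_frontier_of_tendsto' hlim
      (E := toTorus '' G) (by rw [hν]; exact torusMeasure_frontier_image hJ))
  rw [hν, torusMeasure_image hG hJ] at key
  refine key.congr' ?_
  filter_upwards [hμs] with P hP
  rw [Function.comp_apply, hP, empiricalMeasure_apply, W]
  have : ψ ⁻¹' (toTorus '' G) = quasiperiodicSet G Λ :=
    Set.ext fun x => mem_quasiperiodicSet_iff.symm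
  rw [this]

end Torus

/-! ### The algebra of quasiperiodic sets -/

section Algebra

variable {ι : Type*} {n : ℕ}

/-- The coordinatewise fractional part of `Λ x`. -/
def fracPart (Λ : Matrix ι (Fin n) ℝ) (x : Fin n → ℤ) : ι → ℝ :=
  fun i => Int.fract (Λ.mulVec (toReal x) i)

theorem fracPart_mem_unitCube (Λ : Matrix ι (Fin n) ℝ) (x : Fin n → ℤ) :
    fracPart Λ x ∈ unitCube ι := fun _ _ => ⟨Int.fract_nonneg _, Int.fract_lt_one _⟩

theorem quasiperiodicSet_eq_preimage {Λ : Matrix ι (Fin n) ℝ} {G : Set (ι → ℝ)}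
    (hG : G ⊆ unitCube ι) : quasiperiodicSet G Λ = fracPart Λ ⁻¹' G := by
  ext x
  constructor
  · rintro ⟨g, hg, z, h⟩
    have : fracPart Λ x = g := by
      ext i
      have hi := hG hg i trivial
      rw [fracPart, h, Pi.add_apply, toReal, Int.fract_add_intCast, Int.fract_eq_self.2 hi]
    exact Set.mem_preimage.2 (this ▸ hg)
  · intro hx
    exact ⟨_, hx, fun i => ⌊Λ.mulVec (toReal x) i⌋, funext fun i => (Int.fract_add_floor _).symm⟩

theorem isBounded_unitCube : Bornology.IsBounded (unitCube ι) :=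
  Bornology.IsBounded.pi fun _ => Metric.isBounded_Ico 0 1

variable [Fintype ι]

theorem volume_frontier_unitCube : volume (frontier (unitCube ι)) = 0 :=
  (convex_pi fun _ _ => convex_Ico 0 1).addHaar_frontier _

/-- Fractional parts lie in the cube, so `E` may be cut down to it and need not be bounded. Closure
under complements then follows at once. -/
theorem preimage_fracPart_mem (Λ : Matrix ι (Fin n) ℝ) {E : Set (ι → ℝ)}
    (hE : volume (frontier E) = 0) : fracPart Λ ⁻¹' E ∈ quasiperiodicAlgebra Λ := by
  refine ⟨E ∩ unitCube ι, Set.inter_subset_right,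
    ⟨isBounded_unitCube.subset Set.inter_subset_right,
      null_frontier_inter hE volume_frontier_unitCube⟩, ?_⟩
  rw [quasiperiodicSet_eq_preimage Set.inter_subset_right]
  ext x
  simp [fracPart_mem_unitCube]

theorem exists_of_mem_quasiperiodicAlgebra {Λ : Matrix ι (Fin n) ℝ} {A : Set (Fin n → ℤ)}
    (hA : A ∈ quasiperiodicAlgebra Λ) :
    ∃ G ⊆ unitCube ι, JordanMeasurable G ∧ A = fracPart Λ ⁻¹' G := by
  obtain ⟨G, hG, hJ, rfl⟩ := hA
  exact ⟨G, hG, hJ, quasiperiodicSet_eq_preimage hG⟩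

theorem univ_mem_quasiperiodicAlgebra (Λ : Matrix ι (Fin n) ℝ) :
    Set.univ ∈ quasiperiodicAlgebra Λ :=
  preimage_fracPart_mem Λ (E := Set.univ) (by simp)

theorem compl_mem_quasiperiodicAlgebra {Λ : Matrix ι (Fin n) ℝ} {A : Set (Fin n → ℤ)}
    (hA : A ∈ quasiperiodicAlgebra Λ) : Aᶜ ∈ quasiperiodicAlgebra Λ := by
  obtain ⟨G, -, hJ, rfl⟩ := exists_of_mem_quasiperiodicAlgebra hA
  exact preimage_fracPart_mem Λ (E := Gᶜ) (by rw [frontier_compl]; exact hJ.2)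

theorem empty_mem_quasiperiodicAlgebra (Λ : Matrix ι (Fin n) ℝ) :
    ∅ ∈ quasiperiodicAlgebra Λ := by
  simpa using compl_mem_quasiperiodicAlgebra (univ_mem_quasiperiodicAlgebra Λ)

theorem inter_mem_quasiperiodicAlgebra {Λ : Matrix ι (Fin n) ℝ} {A B : Set (Fin n → ℤ)}
    (hA : A ∈ quasiperiodicAlgebra Λ) (hB : B ∈ quasiperiodicAlgebra Λ) :
    A ∩ B ∈ quasiperiodicAlgebra Λ := by
  obtain ⟨G, -, hG, rfl⟩ := exists_of_mem_quasiperiodicAlgebra hA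
  obtain ⟨H, -, hH, rfl⟩ := exists_of_mem_quasiperiodicAlgebra hB
  exact preimage_fracPart_mem Λ (E := G ∩ H) (null_frontier_inter hG.2 hH.2)

theorem union_mem_quasiperiodicAlgebra {Λ : Matrix ι (Fin n) ℝ} {A B : Set (Fin n → ℤ)}
    (hA : A ∈ quasiperiodicAlgebra Λ) (hB : B ∈ quasiperiodicAlgebra Λ) :
    A ∪ B ∈ quasiperiodicAlgebra Λ := by
  rw [← compl_compl (A ∪ B), Set.compl_union]
  exact compl_mem_quasiperiodicAlgebra (inter_mem_quasiperiodicAlgebra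
    (compl_mem_quasiperiodicAlgebra hA) (compl_mem_quasiperiodicAlgebra hB))

theorem biUnion_mem_quasiperiodicAlgebra {Λ : Matrix ι (Fin n) ℝ} {κ : Type*} (s : Finset κ)
    {A : κ → Set (Fin n → ℤ)} (hA : ∀ k, A k ∈ quasiperiodicAlgebra Λ) :
    (⋃ k ∈ s, A k) ∈ quasiperiodicAlgebra Λ := by
  classical
  induction s using Finset.induction_on with
  | empty => simpa using empty_mem_quasiperiodicAlgebra Λ
  | insert k s _ ih =>
    rw [Finset.set_biUnion_insert]
    exact union_mem_quasiperiodicAlgebra (hA k) ih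

open Classical in
theorem card_filter_mem_quasiperiodicAlgebra {Λ : Matrix ι (Fin n) ℝ} {κ : Type*} (s : Finset κ)
    {A : κ → Set (Fin n → ℤ)} (hA : ∀ k, A k ∈ quasiperiodicAlgebra Λ) (j : ℕ) :
    {x | (s.filter fun k => x ∈ A k).card = j} ∈ quasiperiodicAlgebra Λ := by
  induction s using Finset.induction_on generalizing j with
  | empty =>
    by_cases hj : 0 = j
    · simpa [hj] using univ_mem_quasiperiodicAlgebra Λ
    · simpa [hj] using empty_mem_quasiperiodicAlgebra Λ
  | insert k s hk ih =>
    -- Writing `+ 1 = j` avoids truncated subtraction; for `j = 0` the set is empty.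
    have h1 : A k ∩ {x | (s.filter fun k => x ∈ A k).card + 1 = j} ∈ quasiperiodicAlgebra Λ := by
      refine inter_mem_quasiperiodicAlgebra (hA k) ?_
      cases j with
      | zero => simpa using empty_mem_quasiperiodicAlgebra Λ
      | succ j => simpa using ih j
    convert union_mem_quasiperiodicAlgebra h1
      (inter_mem_quasiperiodicAlgebra (compl_mem_quasiperiodicAlgebra (hA k)) (ih j)) using 1
    ext x
    by_cases hx : x ∈ A k
    · simp [Finset.filter_insert, hx, hk]
    · simp [Finset.filter_insert, hx]

end Algebra

/-! ### Measures of preimages under affine maps -/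

section Volume

variable {n : ℕ}

/-- No measurability of `F` is needed, so this applies directly to cells of `R`, which need not be
Borel. -/
theorem volume_preimage_affine {L : Matrix (Fin n) (Fin n) ℝ} (hL : L.det ≠ 0) (c w : Fin n → ℝ)
    (F : Set (Fin n → ℝ)) :
    volume {s : Fin n → ℝ | c + L.mulVec (w - s) ∈ F} = ENNReal.ofReal |L.det⁻¹| * volume F := by
  have h : {s : Fin n → ℝ | c + L.mulVec (w - s) ∈ F} =
      Neg.neg ⁻¹' ((fun s => w + s) ⁻¹' (Matrix.toLin' L ⁻¹' ((fun s => c + s) ⁻¹' F))) := by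
    ext s
    simp [sub_eq_add_neg]
  have hd : LinearMap.det (Matrix.toLin' L) ≠ 0 := by rwa [LinearMap.det_toLin']
  rw [h, Measure.measure_preimage_neg, measure_preimage_add,
    Measure.addHaar_preimage_linearMap _ hd, measure_preimage_add, LinearMap.det_toLin']

theorem measure_prod_apply_of_nullMeasurableSet {α β : Type*} [MeasurableSpace α]
    [MeasurableSpace β] {μ : Measure α} {ν : Measure β} [SFinite μ] [SFinite ν] {s : Set (α × β)}
    (hs : NullMeasurableSet s (μ.prod ν)) :
    (μ.prod ν) s = ∫⁻ x, ν (Prod.mk x ⁻¹' s) ∂μ := by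
  obtain ⟨t, ht, hst⟩ := hs
  rw [measure_congr hst, Measure.prod_apply ht]
  refine lintegral_congr_ae ?_
  filter_upwards [Measure.ae_ae_of_ae_prod hst] with x hx
  exact (measure_congr hx).symm

theorem toReal_add (x y : Fin n → ℤ) : toReal (x + y) = toReal x + toReal y := by
  ext i
  simp [toReal]

theorem toReal_neg (x : Fin n → ℤ) : toReal (-x) = -toReal x := by
  ext i
  simp [toReal]

theorem add_toReal_mem_unitCube_iff {v : Fin n → ℝ} {z : Fin n → ℤ} :
    v + toReal z ∈ unitCube (Fin n) ↔ z = fun i => -⌊v i⌋ := by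
  simp only [unitCube, Set.mem_pi, Set.mem_univ, true_imp_iff, Set.mem_Ico, Pi.add_apply, toReal,
    funext_iff]
  refine forall_congr' fun i => ?_
  rw [eq_neg_iff_add_eq_zero, add_comm (z i), ← eq_neg_iff_add_eq_zero, Int.floor_eq_iff]
  push_cast
  constructor <;> rintro ⟨h1, h2⟩ <;> constructor <;> linarith

theorem measurableSet_add_toReal_mem_unitCube (z : Fin n → ℤ) :
    MeasurableSet {v : Fin n → ℝ | v + toReal z ∈ unitCube (Fin n)} :=
  measurableSet_unitCube.preimage (measurable_id.add_const _)

/-- Slicing a set according to the integer part of a projection to `ℝⁿ`. -/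
theorem measure_eq_tsum_slices {α : Type*} [MeasurableSpace α] (μ : Measure α)
    {q : α → Fin n → ℝ} (hq : Measurable q) (U : Set α) :
    μ U = ∑' z : Fin n → ℤ, μ ({p | q p + toReal z ∈ unitCube (Fin n)} ∩ U) := by
  have hm : ∀ z : Fin n → ℤ, MeasurableSet {p | q p + toReal z ∈ unitCube (Fin n)} := fun z =>
    hq (measurableSet_add_toReal_mem_unitCube z)
  have h : (⋃ z : Fin n → ℤ, {p | q p + toReal z ∈ unitCube (Fin n)}) = Set.univ :=
    Set.eq_univ_of_forall fun p => Set.mem_iUnion.2 ⟨_, add_toReal_mem_unitCube_iff.2 rfl⟩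
  rw [← Measure.restrict_apply_univ, ← h, measure_iUnion _ hm]
  · exact tsum_congr fun z => Measure.restrict_apply (hm z)
  · intro z z' hzz
    refine Set.disjoint_left.2 fun p hp hp' => hzz ?_
    rw [add_toReal_mem_unitCube_iff.1 hp, add_toReal_mem_unitCube_iff.1 hp']

end Volume

/-! ### Quantizers -/

section Quantizer

variable {n : ℕ} {R : (Fin n → ℝ) → (Fin n → ℤ)}

theorem IsQuantizer.apply_eq_iff (hR : IsQuantizer R) {u : Fin n → ℝ} {z : Fin n → ℤ} :
    R u = z ↔ u - toReal z ∈ R ⁻¹' {0} := by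
  rw [Set.mem_preimage, Set.mem_singleton_iff, sub_eq_add_neg, ← toReal_neg, hR.1,
    add_neg_eq_zero]

theorem IsQuantizer.nullMeasurableSet (hR : IsQuantizer R) (z : Fin n → ℤ) :
    NullMeasurableSet (R ⁻¹' {z}) := by
  have h : R ⁻¹' {z} = (fun u => u - toReal z) ⁻¹' (R ⁻¹' {0}) :=
    Set.ext fun u => hR.apply_eq_iff
  rw [h]
  exact (nullMeasurableSet_of_null_frontier hR.2.2).preimage
    (measurePreserving_sub_right volume (toReal z)).quasiMeasurePreserving

/-- Both the cell and the unit cube are fundamental domains for `ℤⁿ`: cutting the cell along integer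
translates of the cube and moving the pieces back into it produces the partition of the cube by the
sets `R ⁻¹' {z}`. -/
theorem IsQuantizer.volume_cell (hR : IsQuantizer R) : volume (R ⁻¹' {0}) = 1 := by
  have h : ∀ z : Fin n → ℤ,
      volume ({v | v + toReal z ∈ unitCube (Fin n)} ∩ R ⁻¹' {0}) =
        volume.restrict (unitCube (Fin n)) (R ⁻¹' {z}) := fun z => by
    rw [Measure.restrict_apply₀' measurableSet_unitCube.nullMeasurableSet,
      ← measure_preimage_add_right volume (toReal z) (R ⁻¹' {z} ∩ unitCube (Fin n))]
    congr 1
    ext v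
    simp [hR.1, and_comm]
  rw [measure_eq_tsum_slices volume measurable_id]
  simp only [id_eq]
  rw [tsum_congr h, ← measure_iUnion₀, ← Set.preimage_iUnion, Set.iUnion_of_singleton,
    Set.preimage_univ, Measure.restrict_apply_univ, volume_unitCube]
  · intro z z' hzz
    exact (Disjoint.preimage R (Set.disjoint_singleton.2 hzz)).aedisjoint
  · exact fun z => (hR.nullMeasurableSet z).mono_ac Measure.restrict_le_self.absolutelyContinuous

end Quantizer

/-! ### The backward matrices -/

section Backward

variable {n : ℕ}

theorem IterativelyNonresonant.nonresonant_backwardMatrix {L : Matrix (Fin n) (Fin n) ℝ}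
    (hL : IterativelyNonresonant L) (N : ℕ) : Nonresonant (backwardMatrix L N) := by
  let e : Fin N × Fin n ≃ Fin (N * n) := finProdFinEquiv
  let r : Fin N × Fin n → {k : ℤ // k ≠ 0} × Fin n :=
    fun p => (⟨-((p.1 : ℤ) + 1), by omega⟩, p.2)
  have hr : Function.Injective r := by
    rintro ⟨i, j⟩ ⟨i', j'⟩ h
    simp only [r, Prod.mk.injEq, Subtype.mk.injEq] at h
    ext
    · simp only
      omega
    · simp [h.2]
  have h := hL.2 (N * n) (r ∘ e.symm) (hr.comp e.symm.injective)
  have h' := h.comp (Sum.map id e) (Function.Injective.sumMap Function.injective_id e.injective)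
  unfold Nonresonant
  convert h' using 1
  funext p
  rcases p with i | p
  · rfl
  · funext j
    change backwardMatrix L N p j = stackedPowers L (r (e.symm (e p))) j
    rw [e.symm_apply_apply]
    rfl

/-- The last block of `t`, or zero if there are no blocks. -/
def lastBlock : {N : ℕ} → (Fin N × Fin n → ℝ) → Fin n → ℝ
  | 0, _ => 0
  | N + 1, t => fun j => t (Fin.last N, j)

theorem continuous_lastBlock {N : ℕ} : Continuous (lastBlock (n := n) (N := N)) := by
  cases N with
  | zero => exact continuous_const
  | succ N => exact continuous_pi fun j => continuous_apply _

theorem lastBlock_mem_Icc {N : ℕ} {t : Fin N × Fin n → ℝ} (ht : t ∈ unitCube (Fin N × Fin n)) :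
    lastBlock t ∈ Set.Icc (0 : Fin n → ℝ) 1 := by
  cases N with
  | zero => exact ⟨le_rfl, fun _ => zero_le_one⟩
  | succ N => exact ⟨fun j => (ht _ trivial).1, fun j => (ht _ trivial).2.le⟩

/-- Separating the last block from the others. -/
def splitLast {N : ℕ} (t : Fin (N + 1) × Fin n → ℝ) : (Fin N × Fin n → ℝ) × (Fin n → ℝ) :=
  (fun p => t (p.1.castSucc, p.2), fun j => t (Fin.last N, j))

theorem continuous_splitLast {N : ℕ} : Continuous (splitLast (n := n) (N := N)) :=
  (continuous_pi fun _ => continuous_apply _).prodMk (continuous_pi fun _ => continuous_apply _)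

/-- The index equivalence underlying `splitLast`. -/
def splitLastIndex (N n : ℕ) : (Fin N × Fin n) ⊕ Fin n ≃ Fin (N + 1) × Fin n :=
  Equiv.ofBijective (Sum.elim (fun p => (p.1.castSucc, p.2)) fun j => (Fin.last N, j)) <| by
    constructor
    · rintro (⟨i, j⟩ | j) (⟨i', j'⟩ | j') h
      · simpa using h
      · simp [Fin.castSucc_ne_last] at h
      · simp [(Fin.castSucc_ne_last _).symm] at h
      · simpa using h
    · rintro ⟨i, j⟩
      induction i using Fin.lastCases with
      | last => exact ⟨Sum.inr j, rfl⟩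
      | cast i => exact ⟨Sum.inl (i, j), rfl⟩

theorem measurePreserving_splitLast {N : ℕ} :
    MeasurePreserving (splitLast (n := n) (N := N)) volume (volume.prod volume) :=
  (volume_measurePreserving_sumPiEquivProdPi fun _ : (Fin N × Fin n) ⊕ Fin n => ℝ).comp
    (volume_measurePreserving_piCongrLeft (fun _ => ℝ) (splitLastIndex N n)).symm

theorem volume_frontier_preimage_splitLast {N : ℕ} {E : Set ((Fin N × Fin n → ℝ) × (Fin n → ℝ))}
    (hE : volume (frontier E) = 0) : volume (frontier (splitLast ⁻¹' E)) = 0 :=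
  measure_mono_null (continuous_splitLast.frontier_preimage_subset E)
    (measurePreserving_splitLast.quasiMeasurePreserving.preimage_null hE)

theorem splitLast_mem_iff {N : ℕ} {t : Fin (N + 1) × Fin n → ℝ} :
    t ∈ unitCube (Fin (N + 1) × Fin n) ↔
      (splitLast t).1 ∈ unitCube (Fin N × Fin n) ∧ (splitLast t).2 ∈ unitCube (Fin n) := by
  constructor
  · exact fun h => ⟨fun _ _ => h _ trivial, fun _ _ => h _ trivial⟩
  · rintro ⟨h1, h2⟩ ⟨i, j⟩ -
    induction i using Fin.lastCases with
    | last => exact h2 j trivial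
    | cast i => exact h1 (i, j) trivial

/-- The fractional part of `L⁻ᵏ x`. -/
def backwardFract (L : Matrix (Fin n) (Fin n) ℝ) (k : ℕ) (x : Fin n → ℤ) : Fin n → ℝ :=
  fun j => Int.fract ((L ^ (-(k : ℤ))).mulVec (toReal x) j)

/-- The integer part of `L⁻ᵏ x`. -/
def backwardFloor (L : Matrix (Fin n) (Fin n) ℝ) (k : ℕ) (x : Fin n → ℤ) : Fin n → ℤ :=
  fun j => ⌊(L ^ (-(k : ℤ))).mulVec (toReal x) j⌋

theorem backwardFract_add_floor (L : Matrix (Fin n) (Fin n) ℝ) (k : ℕ) (x : Fin n → ℤ) :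
    backwardFract L k x + toReal (backwardFloor L k x) = (L ^ (-(k : ℤ))).mulVec (toReal x) :=
  funext fun _ => Int.fract_add_floor _

theorem backwardFloor_zero (L : Matrix (Fin n) (Fin n) ℝ) (x : Fin n → ℤ) :
    backwardFloor L 0 x = x := by
  ext j
  simp [backwardFloor, toReal]

theorem splitLast_fracPart (L : Matrix (Fin n) (Fin n) ℝ) (N : ℕ) (x : Fin n → ℤ) :
    splitLast (fracPart (backwardMatrix L (N + 1)) x) =
      (fracPart (backwardMatrix L N) x, backwardFract L (N + 1) x) := by
  refine Prod.ext ?_ ?_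
  · rfl
  · funext j
    simp [splitLast, fracPart, backwardMatrix, backwardFract, Matrix.mulVec, dotProduct]

/-- For `N = 0` the convention `lastBlock = 0` is the right one, because `L⁰ x = x` is integral. -/
theorem lastBlock_fracPart (L : Matrix (Fin n) (Fin n) ℝ) (N : ℕ) (x : Fin n → ℤ) :
    lastBlock (fracPart (backwardMatrix L N) x) = backwardFract L N x := by
  cases N with
  | zero =>
    funext j
    simp [lastBlock, backwardFract, toReal]
  | succ N => exact congrArg Prod.snd (splitLast_fracPart L N x)

/-- A Jordan set for `N` blocks is replaced by the cylinder over it. -/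
theorem backwardAlgebra_subset_succ (L : Matrix (Fin n) (Fin n) ℝ) (N : ℕ) :
    backwardAlgebra L N ⊆ backwardAlgebra L (N + 1) := by
  intro A hA
  obtain ⟨G, -, hJ, rfl⟩ := exists_of_mem_quasiperiodicAlgebra hA
  have h : volume (frontier (Prod.fst ⁻¹' G : Set ((Fin N × Fin n → ℝ) × (Fin n → ℝ)))) = 0 :=
    measure_mono_null (continuous_fst.frontier_preimage_subset G)
      (Measure.quasiMeasurePreserving_fst.preimage_null hJ.2)
  have := preimage_fracPart_mem (backwardMatrix L (N + 1)) (volume_frontier_preimage_splitLast h)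
  simp only [← Set.preimage_comp, Function.comp_def, splitLast_fracPart] at this
  exact this

end Backward

/-! ### Preimages under the transition operator -/

section Transition

variable {n : ℕ} {R : (Fin n → ℝ) → (Fin n → ℤ)} {L : Matrix (Fin n) (Fin n) ℝ}

/-- As `L · L⁻ᵏ⁻¹ x = L⁻ᵏ x`, the integer part of `L⁻ᵏ x` can be pulled out of `R`; what remains
depends on `x` only through fractional parts. -/
theorem transition_add_backwardFloor (hR : IsQuantizer R) (hL : L.det ≠ 0) (k : ℕ)
    (x z : Fin n → ℤ) :
    transition R L (z + backwardFloor L (k + 1) x) =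
      R (backwardFract L k x + L.mulVec (toReal z - backwardFract L (k + 1) x)) +
        backwardFloor L k x := by
  have hu : IsUnit L.det := isUnit_iff_ne_zero.2 hL
  have h1 : L * L ^ (-((k + 1 : ℕ) : ℤ)) = L ^ (-(k : ℤ)) := by
    rw [← Matrix.zpow_one_add hu]
    congr 1
    push_cast
    ring
  have h2 := backwardFract_add_floor L (k + 1) x
  rw [transition, ← hR.1]
  congr 1
  rw [toReal_add, eq_sub_of_add_eq' h2, add_right_comm, backwardFract_add_floor, ← h1,
    ← Matrix.mulVec_mulVec, ← Matrix.mulVec_add]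
  congr 1
  abel

/-- The lattice points `x` for which `z + ⌊L⁻ᵏ x⌋` is mapped to `x` by `Tᵏ`. -/
def preimageOffsetSet (R : (Fin n → ℝ) → (Fin n → ℤ)) (L : Matrix (Fin n) (Fin n) ℝ) (k : ℕ)
    (z : Fin n → ℤ) : Set (Fin n → ℤ) :=
  {x | (transition R L)^[k] (z + backwardFloor L k x) = x}

/-- The pairs of fractional parts for which the offset `z` is mapped to the offset `z'`. -/
def offsetCell (R : (Fin n → ℝ) → (Fin n → ℤ)) (L : Matrix (Fin n) (Fin n) ℝ) (k : ℕ)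
    (z z' : Fin n → ℤ) : Set ((Fin k × Fin n → ℝ) × (Fin n → ℝ)) :=
  {p | R (lastBlock p.1 + L.mulVec (toReal z - p.2)) = z'}

/-- The lattice points `x` for which `T` maps `z + ⌊L⁻ᵏ⁻¹ x⌋` to `z' + ⌊L⁻ᵏ x⌋`. -/
def offsetStep (R : (Fin n → ℝ) → (Fin n → ℤ)) (L : Matrix (Fin n) (Fin n) ℝ) (k : ℕ)
    (z z' : Fin n → ℤ) : Set (Fin n → ℤ) :=
  {x | R (backwardFract L k x + L.mulVec (toReal z - backwardFract L (k + 1) x)) = z'}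

theorem offsetStep_eq (k : ℕ) (z z' : Fin n → ℤ) :
    offsetStep R L k z z' =
      fracPart (backwardMatrix L (k + 1)) ⁻¹' (splitLast ⁻¹' offsetCell R L k z z') := by
  ext x
  simp only [offsetStep, offsetCell, Set.mem_preimage, splitLast_fracPart, Set.mem_ofPred_eq,
    lastBlock_fracPart]

/-- The first application of `T` lands at `z' + ⌊L⁻ᵏ x⌋` for exactly one `z'`; the remaining `k`
applications must lead to `x`. -/
theorem mem_preimageOffsetSet_succ (hR : IsQuantizer R) (hL : L.det ≠ 0) {k : ℕ}
    {x z : Fin n → ℤ} :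
    x ∈ preimageOffsetSet R L (k + 1) z ↔
      ∃ z', x ∈ preimageOffsetSet R L k z' ∧ x ∈ offsetStep R L k z z' := by
  simp only [preimageOffsetSet, offsetStep, Set.mem_ofPred_eq, Function.iterate_succ_apply,
    transition_add_backwardFloor hR hL, exists_eq_right']

/-- For each fixed first component the boundary condition on the second is an affine preimage of the
null frontier of the cell, so Fubini applies. -/
theorem volume_frontier_offsetCell (hR : IsQuantizer R) (hL : L.det ≠ 0) (k : ℕ)
    (z z' : Fin n → ℤ) : volume (frontier (offsetCell R L k z z')) = 0 := by
  have hf : Continuous fun p : (Fin k × Fin n → ℝ) × (Fin n → ℝ) =>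
      lastBlock p.1 + L.mulVec (toReal z - p.2) - toReal z' := by
    have h1 := continuous_lastBlock (n := n) (N := k)
    have h2 : Continuous fun v : Fin n → ℝ => L.mulVec v := continuous_const.matrix_mulVec continuous_id
    fun_prop
  have h : offsetCell R L k z z' =
      (fun p => lastBlock p.1 + L.mulVec (toReal z - p.2) - toReal z') ⁻¹' (R ⁻¹' {0}) :=
    Set.ext fun p => hR.apply_eq_iff
  rw [h]
  refine measure_mono_null (hf.frontier_preimage_subset _) ?_
  rw [Measure.volume_eq_prod, Measure.measure_prod_null (isClosed_frontier.preimage hf).measurableSet]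
  refine ae_of_all _ fun t => ?_
  have := volume_preimage_affine hL (lastBlock t - toReal z') (toReal z) (frontier (R ⁻¹' {0}))
  rw [hR.2.2, mul_zero] at this
  refine (congrArg volume (Set.ext fun s => ?_)).trans this
  simp only [Set.mem_preimage, Set.mem_ofPred_eq]
  rw [sub_add_eq_add_sub]

theorem offsetStep_mem_backwardAlgebra (hR : IsQuantizer R) (hL : L.det ≠ 0) (k : ℕ)
    (z z' : Fin n → ℤ) : offsetStep R L k z z' ∈ backwardAlgebra L (k + 1) := by
  rw [offsetStep_eq]
  exact preimage_fracPart_mem _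
    (volume_frontier_preimage_splitLast (volume_frontier_offsetCell hR hL k z z'))

theorem finite_of_isBounded_toReal {S : Set (Fin n → ℤ)} (hS : Bornology.IsBounded (toReal '' S)) :
    S.Finite := by
  obtain ⟨C, hC⟩ := hS.exists_norm_le
  refine (Set.finite_Icc (fun _ => -⌈C⌉) (fun _ => ⌈C⌉)).subset fun z hz => ?_
  have h : ∀ i, |z i| ≤ ⌈C⌉ := fun i => by
    have h1 : |(z i : ℝ)| ≤ C := (norm_le_pi_norm (toReal z) i).trans (hC _ ⟨z, hz, rfl⟩)
    exact_mod_cast h1.trans (Int.le_ceil C)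
  exact ⟨fun i => (abs_le.1 (h i)).1, fun i => (abs_le.1 (h i)).2⟩

/-- Up to a finite set, no offset is mapped to `z'`. -/
theorem exists_finset_offsetCell (hR : IsQuantizer R) (hL : L.det ≠ 0) (k : ℕ) (z' : Fin n → ℤ) :
    ∃ Z : Finset (Fin n → ℤ), ∀ z, ∀ p ∈ offsetCell R L k z z',
      p.1 ∈ unitCube (Fin k × Fin n) → p.2 ∈ unitCube (Fin n) → z ∈ Z := by
  let S : Set (Fin n → ℤ) := {z | ∃ p ∈ offsetCell R L k z z',
      p.1 ∈ unitCube (Fin k × Fin n) ∧ p.2 ∈ unitCube (Fin n)}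
  have hS : S.Finite := by
    refine finite_of_isBounded_toReal ?_
    -- Solving the cell condition for `z` gives `z = s + L⁻¹(c + z' - lastBlock t)` with `c` in the
    -- cell, so `z` lies in a continuous image of a compact set.
    let g : (Fin n → ℝ) × (Fin n → ℝ) × (Fin n → ℝ) → Fin n → ℝ :=
      fun q => q.1 + L⁻¹.mulVec (q.2.1 + toReal z' - q.2.2)
    have hg : Continuous g := by
      have h2 : Continuous fun v : Fin n → ℝ => L⁻¹.mulVec v :=
        continuous_const.matrix_mulVec continuous_id
      fun_prop
    have hK : IsCompact (Set.Icc (0 : Fin n → ℝ) 1 ×ˢ closure (R ⁻¹' {0}) ×ˢ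
        Set.Icc (0 : Fin n → ℝ) 1) :=
      isCompact_Icc.prod (hR.2.1.isCompact_closure.prod isCompact_Icc)
    refine (hK.image hg).isBounded.subset ?_
    rintro _ ⟨z, ⟨p, hp, h1, h2⟩, rfl⟩
    refine ⟨(p.2, lastBlock p.1 + L.mulVec (toReal z - p.2) - toReal z', lastBlock p.1),
      ⟨⟨fun i => (h2 i trivial).1, fun i => (h2 i trivial).2.le⟩,
        subset_closure (hR.apply_eq_iff.1 hp), lastBlock_mem_Icc h1⟩, ?_⟩
    simp only [g]
    rw [sub_add_cancel, add_sub_cancel_left, Matrix.mulVec_mulVec,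
      Matrix.nonsing_inv_mul _ (isUnit_iff_ne_zero.2 hL), Matrix.one_mulVec, add_sub_cancel]
  exact ⟨hS.toFinset, fun z p hp h1 h2 => hS.mem_toFinset.2 ⟨p, hp, h1, h2⟩⟩

/-- Each offset at level `k` is reached from finitely many offsets at level `k + 1`. The finite set
is uniform in `x`, which makes `ν_k` a finite sum of indicators. -/
theorem exists_finset_preimageOffsetSet (hR : IsQuantizer R) (hL : L.det ≠ 0) (k : ℕ) :
    ∃ Z : Finset (Fin n → ℤ), ∀ z, (preimageOffsetSet R L k z).Nonempty → z ∈ Z := by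
  classical
  induction k with
  | zero =>
    refine ⟨{0}, fun z ⟨x, hx⟩ => ?_⟩
    simpa [preimageOffsetSet, backwardFloor_zero] using hx
  | succ k ih =>
    obtain ⟨Z, hZ⟩ := ih
    choose Y hY using exists_finset_offsetCell hR hL k
    refine ⟨Z.biUnion Y, fun z ⟨x, hx⟩ => ?_⟩
    obtain ⟨z', hx', hs⟩ := (mem_preimageOffsetSet_succ hR hL).1 hx
    rw [offsetStep_eq] at hs
    have hc := splitLast_mem_iff.1 (fracPart_mem_unitCube (backwardMatrix L (k + 1)) x)
    exact Finset.mem_biUnion.2 ⟨z', hZ z' ⟨x, hx'⟩, hY z' z _ hs hc.1 hc.2⟩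

theorem preimageOffsetSet_mem_backwardAlgebra (hR : IsQuantizer R) (hL : L.det ≠ 0) (k : ℕ)
    (z : Fin n → ℤ) : preimageOffsetSet R L k z ∈ backwardAlgebra L k := by
  induction k generalizing z with
  | zero =>
    by_cases hz : z = 0
    · convert! univ_mem_quasiperiodicAlgebra (backwardMatrix L 0) using 1
      exact Set.eq_univ_of_forall fun x => by simp [preimageOffsetSet, backwardFloor_zero, hz]
    · convert! empty_mem_quasiperiodicAlgebra (backwardMatrix L 0) using 1
      exact Set.eq_empty_of_forall_notMem fun x => by
        simp [preimageOffsetSet, backwardFloor_zero, hz]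
  | succ k ih =>
    obtain ⟨Z, hZ⟩ := exists_finset_preimageOffsetSet hR hL k
    have : preimageOffsetSet R L (k + 1) z =
        ⋃ z' ∈ Z, preimageOffsetSet R L k z' ∩ offsetStep R L k z z' := by
      ext x
      simp only [mem_preimageOffsetSet_succ hR hL, Set.mem_iUnion, Set.mem_inter_iff, exists_prop]
      exact exists_congr fun z' => ⟨fun h => ⟨hZ z' ⟨x, h.1⟩, h⟩, And.right⟩
    rw [this]
    exact biUnion_mem_quasiperiodicAlgebra Z fun z' =>
      inter_mem_quasiperiodicAlgebra (backwardAlgebra_subset_succ L k (ih z'))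
        (offsetStep_mem_backwardAlgebra hR hL k z z')

theorem preimageSet_eq_image (k : ℕ) (x : Fin n → ℤ) :
    preimageSet R L k x =
      (fun z => z + backwardFloor L k x) '' {z | x ∈ preimageOffsetSet R L k z} := by
  ext y
  simp only [preimageSet, preimageOffsetSet, Set.mem_image, Set.mem_ofPred_eq]
  constructor
  · exact fun h => ⟨y - backwardFloor L k x, by rwa [sub_add_cancel], sub_add_cancel _ _⟩
  · rintro ⟨z, hz, rfl⟩
    exact hz

open Classical in
theorem preimageCard_eq_card_filter {k : ℕ} {Z : Finset (Fin n → ℤ)}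
    (hZ : ∀ z, (preimageOffsetSet R L k z).Nonempty → z ∈ Z) (x : Fin n → ℤ) :
    preimageCard R L k x = (Z.filter fun z => x ∈ preimageOffsetSet R L k z).card := by
  rw [preimageCard, preimageSet_eq_image, Set.ncard_image_of_injective _ (add_left_injective _),
    ← Set.ncard_coe_finset]
  congr 1
  ext z
  simp only [Set.mem_ofPred_eq, Finset.coe_filter]
  exact ⟨fun h => ⟨hZ z ⟨x, h⟩, h⟩, And.right⟩

theorem preimageCard_eq_sum_indicator {k : ℕ} {Z : Finset (Fin n → ℤ)}
    (hZ : ∀ z, (preimageOffsetSet R L k z).Nonempty → z ∈ Z) (x : Fin n → ℤ) :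
    (preimageCard R L k x : ℝ) =
      ∑ z ∈ Z, (preimageOffsetSet R L k z).indicator (fun _ => (1 : ℝ)) x := by
  classical
  rw [preimageCard_eq_card_filter hZ, Finset.card_filter]
  push_cast
  exact Finset.sum_congr rfl fun z _ => by simp [Set.indicator_apply]

theorem finite_preimageSet (hR : IsQuantizer R) (hL : L.det ≠ 0) (k : ℕ) (x : Fin n → ℤ) :
    (preimageSet R L k x).Finite := by
  obtain ⟨Z, hZ⟩ := exists_finset_preimageOffsetSet hR hL k
  rw [preimageSet_eq_image]
  exact (Z.finite_toSet.subset fun z hz => hZ z ⟨x, hz⟩).image _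

theorem levelSet_mem_backwardAlgebra (hR : IsQuantizer R) (hL : L.det ≠ 0) (k j : ℕ) :
    {x | preimageCard R L k x = j} ∈ backwardAlgebra L k := by
  classical
  obtain ⟨Z, hZ⟩ := exists_finset_preimageOffsetSet hR hL k
  simp only [preimageCard_eq_card_filter hZ]
  exact card_filter_mem_quasiperiodicAlgebra Z
    (fun z => preimageOffsetSet_mem_backwardAlgebra hR hL k z) j

theorem exists_preimageCard_le (hR : IsQuantizer R) (hL : L.det ≠ 0) (k : ℕ) :
    ∃ C : ℝ, ∀ x, (preimageCard R L k x : ℝ) ≤ C := by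
  classical
  obtain ⟨Z, hZ⟩ := exists_finset_preimageOffsetSet hR hL k
  refine ⟨Z.card, fun x => ?_⟩
  rw [preimageCard_eq_card_filter hZ]
  exact_mod_cast Finset.card_filter_le _ _

end Transition

/-! ### The martingale property -/

section Martingale

variable {n : ℕ} {R : (Fin n → ℝ) → (Fin n → ℤ)} {L : Matrix (Fin n) (Fin n) ℝ}

/-- The shift `s ↦ s + z` turns the condition for offset `z` into the one for offset `0`, while the
cube becomes its translate by `-z`. The pieces reassemble into `U`, whose fibre over every `t ∈ G`
has volume `|det L|⁻¹`; independence of `t` is the martingale property. -/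
theorem tsum_volume_offsetCell (hR : IsQuantizer R) (hL : L.det ≠ 0) (k : ℕ) (z' : Fin n → ℤ)
    {G : Set (Fin k × Fin n → ℝ)} (hG : volume (frontier G) = 0) :
    ∑' z : Fin n → ℤ, volume (G ×ˢ unitCube (Fin n) ∩ offsetCell R L k z z') =
      ENNReal.ofReal |L.det⁻¹| * volume G := by
  set U : Set ((Fin k × Fin n → ℝ) × (Fin n → ℝ)) := Prod.fst ⁻¹' G ∩ offsetCell R L k 0 z'
    with hU
  have hUn : NullMeasurableSet U (volume.prod volume) :=
    ((nullMeasurableSet_of_null_frontier hG).preimage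
      Measure.quasiMeasurePreserving_fst).inter
      (nullMeasurableSet_of_null_frontier (volume_frontier_offsetCell hR hL k 0 z'))
  have hslice : ∀ z : Fin n → ℤ, volume (G ×ˢ unitCube (Fin n) ∩ offsetCell R L k z z') =
      volume ({p | p.2 + toReal z ∈ unitCube (Fin n)} ∩ U) := fun z => by
    rw [Measure.volume_eq_prod, ← measure_preimage_add_right (volume.prod volume)
      ((0, toReal z) : (Fin k × Fin n → ℝ) × (Fin n → ℝ))]
    congr 1
    ext p
    have h0 : (toReal 0 : Fin n → ℝ) = 0 := by
      ext
      simp [toReal]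
    simp only [hU, offsetCell, Set.mem_preimage, Set.mem_inter_iff, Set.mem_prod,
      Set.mem_ofPred_eq, Prod.fst_add, Prod.snd_add, add_zero, h0, zero_sub,
      sub_add_cancel_right]
    tauto
  rw [tsum_congr hslice, ← measure_eq_tsum_slices volume measurable_snd U,
    Measure.volume_eq_prod, measure_prod_apply_of_nullMeasurableSet hUn]
  have hfib : ∀ t, volume (Prod.mk t ⁻¹' U) =
      G.indicator (fun _ => ENNReal.ofReal |L.det⁻¹|) t := fun t => by
    by_cases ht : t ∈ G
    · have := volume_preimage_affine hL (lastBlock t - toReal z') (toReal 0) (R ⁻¹' {0})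
      rw [hR.volume_cell, mul_one] at this
      rw [Set.indicator_of_mem ht, ← this]
      congr 1
      ext s
      simp only [hU, offsetCell, Set.mem_preimage, Set.mem_inter_iff, Set.mem_ofPred_eq, ht,
        true_and]
      rw [hR.apply_eq_iff, sub_add_eq_add_sub]
      rfl
    · rw [Set.indicator_of_notMem ht]
      convert measure_empty (μ := volume)
      exact Set.eq_empty_of_forall_notMem fun s hs => ht hs.1
  simp only [hfib]
  rw [lintegral_indicator_const₀ (nullMeasurableSet_of_null_frontier hG)]

/-- Offsets outside `Z₀` contribute empty sets, so any larger finite sum has the full value. The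
freedom in `Z` lets one finite set serve all `z'` simultaneously. -/
theorem exists_tendsto_W_offsetStep (hR : IsQuantizer R) (hL : IterativelyNonresonant L) (k : ℕ)
    (z' : Fin n → ℤ) {A : Set (Fin n → ℤ)} (hA : A ∈ backwardAlgebra L k) :
    ∃ (a : ℝ) (Z₀ : Finset (Fin n → ℤ)),
      Tendsto (W (A.indicator fun _ => (1 : ℝ))) (boxFilter n) (𝓝 a) ∧
      ∀ Z, Z₀ ⊆ Z → Tendsto
        (W fun x => ∑ z ∈ Z, (A ∩ offsetStep R L k z z').indicator (fun _ => (1 : ℝ)) x)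
        (boxFilter n) (𝓝 (|L.det|⁻¹ * a)) := by
  obtain ⟨G, hG, hJ, rfl⟩ := exists_of_mem_quasiperiodicAlgebra hA
  obtain ⟨Z₀, hZ₀⟩ := exists_finset_offsetCell hR hL.1 k z'
  have hA' := (hL.nonresonant_backwardMatrix k).tendsto_W_indicator hG hJ
  rw [quasiperiodicSet_eq_preimage hG] at hA'
  refine ⟨(volume G).toReal, Z₀, hA', fun Z hZ => ?_⟩
  let E : (Fin n → ℤ) → Set ((Fin k × Fin n → ℝ) × (Fin n → ℝ)) :=
    fun z => G ×ˢ unitCube (Fin n) ∩ offsetCell R L k z z'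
  have hEf : ∀ z, volume (frontier (E z)) = 0 := fun z => by
    refine null_frontier_inter ?_ (volume_frontier_offsetCell hR hL.1 k z z')
    rw [Set.prod_eq]
    exact null_frontier_inter
      (measure_mono_null (continuous_fst.frontier_preimage_subset G)
        (Measure.quasiMeasurePreserving_fst.preimage_null hJ.2))
      (measure_mono_null (continuous_snd.frontier_preimage_subset _)
        (Measure.quasiMeasurePreserving_snd.preimage_null volume_frontier_unitCube))
  have hEc : ∀ z, splitLast ⁻¹' E z ⊆ unitCube (Fin (k + 1) × Fin n) := fun z t ht =>
    splitLast_mem_iff.2 ⟨hG ht.1.1, ht.1.2⟩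
  have hEs : ∀ z, fracPart (backwardMatrix L k) ⁻¹' G ∩ offsetStep R L k z z' =
      quasiperiodicSet (splitLast ⁻¹' E z) (backwardMatrix L (k + 1)) := fun z => by
    rw [quasiperiodicSet_eq_preimage (hEc z), offsetStep_eq]
    ext x
    have hc := splitLast_mem_iff.1 (fracPart_mem_unitCube (backwardMatrix L (k + 1)) x)
    rw [splitLast_fracPart] at hc
    simp only [E, Set.mem_inter_iff, Set.mem_preimage, splitLast_fracPart, Set.mem_prod, hc.2,
      and_true]
  have hEv : ∀ z, volume (splitLast ⁻¹' E z) = volume (E z) := fun z =>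
    measurePreserving_splitLast.measure_preimage (nullMeasurableSet_of_null_frontier (hEf z))
  have hlim : ∀ z, Tendsto (W ((fracPart (backwardMatrix L k) ⁻¹' G ∩
      offsetStep R L k z z').indicator fun _ => (1 : ℝ))) (boxFilter n)
      (𝓝 (volume (E z)).toReal) := fun z => by
    rw [hEs, ← hEv]
    exact (hL.nonresonant_backwardMatrix (k + 1)).tendsto_W_indicator (hEc z)
      ⟨isBounded_unitCube.subset (hEc z), volume_frontier_preimage_splitLast (hEf z)⟩
  have hsum : ∑ z ∈ Z, volume (E z) = ENNReal.ofReal |L.det⁻¹| * volume G := by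
    rw [← tsum_volume_offsetCell hR hL.1 k z' hJ.2, tsum_eq_sum]
    intro z hz
    convert measure_empty (μ := volume)
    exact Set.eq_empty_of_forall_notMem fun p hp =>
      hz (hZ (hZ₀ z p hp.2 (hG hp.1.1) hp.1.2))
  have hfin : ∀ z, volume (E z) ≠ ⊤ := fun z => by
    rw [← hEv]
    exact ((measure_mono (hEc z)).trans_lt (by rw [volume_unitCube]; simp)).ne
  have hlimit : |L.det|⁻¹ * (volume G).toReal = ∑ z ∈ Z, (volume (E z)).toReal := by
    rw [← ENNReal.toReal_sum fun z _ => hfin z, hsum, ENNReal.toReal_mul,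
      ENNReal.toReal_ofReal (abs_nonneg _), abs_inv]
  rw [hlimit]
  refine (tendsto_finsetSum Z fun z _ => hlim z).congr fun P => ?_
  rw [W_sum]

theorem exists_tendsto_W_indicator_preimageCard (hR : IsQuantizer R)
    (hL : IterativelyNonresonant L) (k : ℕ) {A : Set (Fin n → ℤ)} (hA : A ∈ backwardAlgebra L k) :
    ∃ a : ℝ,
      Tendsto (W (A.indicator fun x => (preimageCard R L k x : ℝ))) (boxFilter n) (𝓝 a) ∧
      Tendsto (W (A.indicator fun x => (preimageCard R L (k + 1) x : ℝ))) (boxFilter n)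
        (𝓝 (|L.det|⁻¹ * a)) := by
  classical
  obtain ⟨Z, hZ⟩ := exists_finset_preimageOffsetSet hR hL.1 k
  obtain ⟨Y, hY⟩ := exists_finset_preimageOffsetSet hR hL.1 (k + 1)
  -- Conditioning on `z'` being a valid offset at level `k` keeps the set in `Q_k^-`, so the
  -- one-step limit applies to it.
  choose a V h1 h2 using fun z' => exists_tendsto_W_offsetStep hR hL k z'
    (inter_mem_quasiperiodicAlgebra hA (preimageOffsetSet_mem_backwardAlgebra hR hL.1 k z'))
  refine ⟨∑ z' ∈ Z, a z', ?_, ?_⟩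
  · refine (tendsto_finsetSum Z fun z' _ => h1 z').congr fun P => ?_
    rw [← W_sum]
    congr 1
    funext x
    by_cases hx : x ∈ A
    · simp [preimageCard_eq_sum_indicator hZ, Set.indicator_apply, hx]
    · simp [hx]
  · have hsub : ∀ z' ∈ Z, V z' ⊆ Y ∪ Z.biUnion V := fun z' hz' =>
      (Finset.subset_biUnion_of_mem V hz').trans Finset.subset_union_right
    rw [Finset.mul_sum]
    refine (tendsto_finsetSum Z fun z' hz' => h2 z' _ (hsub z' hz')).congr fun P => ?_
    rw [← W_sum]
    congr 1
    funext x
    by_cases hx : x ∈ A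
    · rw [Set.indicator_of_mem hx, preimageCard_eq_sum_indicator
        (fun z hz => Finset.mem_union_left (Z.biUnion V) (hY z hz)), Finset.sum_comm]
      refine Finset.sum_congr rfl fun z _ => ?_
      by_cases hz : x ∈ preimageOffsetSet R L (k + 1) z
      · obtain ⟨z', hz', hs⟩ := (mem_preimageOffsetSet_succ hR hL.1).1 hz
        rw [Set.indicator_of_mem hz, Finset.sum_eq_single_of_mem z' (hZ z' ⟨x, hz'⟩),
          Set.indicator_of_mem (Set.mem_inter (Set.mem_inter hx hz') hs)]
        -- The step determines its target, so only `z'` contributes and each preimage is counted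
        -- once.
        intro w _ hw
        exact Set.indicator_of_notMem (fun h => hw (h.2.symm.trans hs)) _
      · rw [Set.indicator_of_notMem hz]
        refine Finset.sum_eq_zero fun z' _ => Set.indicator_of_notMem (fun h => hz ?_) _
        exact (mem_preimageOffsetSet_succ hR hL.1).2 ⟨z', h.1.2, h.2⟩
    · simp [hx]

theorem tendsto_W_preimageCard (hR : IsQuantizer R) (hL : IterativelyNonresonant L) (k : ℕ) :
    Tendsto (W fun x => (preimageCard R L k x : ℝ)) (boxFilter n) (𝓝 (|L.det| ^ k)⁻¹) := by
  induction k with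
  | zero =>
    refine tendsto_const_nhds.congr' ?_
    filter_upwards [eventually_nonempty n] with P hP
    have h : (P.card : ℝ) ≠ 0 := by exact_mod_cast hP.card_pos.ne'
    simp [W, preimageCard, preimageSet, h]
  | succ k ih =>
    obtain ⟨a, h1, h2⟩ := exists_tendsto_W_indicator_preimageCard hR hL k
      (univ_mem_quasiperiodicAlgebra (backwardMatrix L k))
    rw [Set.indicator_univ] at h1 h2
    rwa [tendsto_nhds_unique h1 ih, ← mul_inv, ← pow_succ'] at h2

theorem hasAverage_indicator_rescaledCard (hR : IsQuantizer R) (hL : L.det ≠ 0) {k : ℕ} {a : ℝ}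
    {A : Set (Fin n → ℤ)}
    (h : Tendsto (W (A.indicator fun x => (preimageCard R L k x : ℝ))) (boxFilter n) (𝓝 a)) :
    HasAverage (A.indicator (rescaledCard R L k)) (|L.det| ^ k * a) := by
  obtain ⟨C, hC⟩ := exists_preimageCard_le hR hL k
  have hf : A.indicator (rescaledCard R L k) =
      fun x => |L.det| ^ k * A.indicator (fun x => (preimageCard R L k x : ℝ)) x := by
    funext x
    by_cases hx : x ∈ A <;> simp [hx, rescaledCard]
  refine HasAverage.of_tendsto ⟨|L.det| ^ k * C, fun x => ?_⟩ ?_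
  · rw [hf, abs_of_nonneg (mul_nonneg (by positivity)
      (Set.indicator_nonneg (fun _ _ => Nat.cast_nonneg _) _))]
    refine mul_le_mul_of_nonneg_left ?_ (by positivity)
    exact (Set.indicator_le_self' (fun _ _ => Nat.cast_nonneg _) x).trans (hC x)
  · rw [hf]
    exact (h.const_mul _).congr fun P => (W_const_mul _ _ P).symm

end Martingale

end QuantizedLinear

end

theorem mainTheorem7 {n : ℕ} (R : (Fin n → ℝ) → (Fin n → ℤ)) (L : Matrix (Fin n) (Fin n) ℝ)
    (hR : QuantizedLinear.IsQuantizer R) (hL : QuantizedLinear.IterativelyNonresonant L) :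
    (∀ (k : ℕ) (x : Fin n → ℤ), (QuantizedLinear.preimageSet R L k x).Finite) ∧
    (∀ N : ℕ, 1 ≤ N → ∀ j : ℕ,
      {x : Fin n → ℤ | QuantizedLinear.preimageCard R L N x = j} ∈
        QuantizedLinear.backwardAlgebra L N) ∧
    (∀ N : ℕ, 1 ≤ N → ∀ A ∈ QuantizedLinear.backwardAlgebra L N, ∃ a : ℝ,
      QuantizedLinear.HasAverage
        (A.indicator (QuantizedLinear.rescaledCard R L (N + 1))) a ∧
      QuantizedLinear.HasAverage
        (A.indicator (QuantizedLinear.rescaledCard R L N)) a) ∧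
    (∀ k : ℕ, 1 ≤ k →
      QuantizedLinear.HasAverage
        (fun x => (QuantizedLinear.preimageCard R L k x : ℝ)) ((|L.det| ^ k)⁻¹)) := by
  refine ⟨QuantizedLinear.finite_preimageSet hR hL.1,
    fun N _ j => QuantizedLinear.levelSet_mem_backwardAlgebra hR hL.1 N j, fun N _ A hA => ?_,
    fun k _ => ?_⟩
  · obtain ⟨a, h1, h2⟩ := QuantizedLinear.exists_tendsto_W_indicator_preimageCard hR hL N hA
    refine ⟨|L.det| ^ N * a, ?_, QuantizedLinear.hasAverage_indicator_rescaledCard hR hL.1 h1⟩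
    have h := QuantizedLinear.hasAverage_indicator_rescaledCard hR hL.1 h2
    -- The extra factor `|det L|` in the rescaling cancels the `|det L|⁻¹` gained in the step.
    rwa [pow_succ, mul_assoc, mul_inv_cancel_left₀ (abs_ne_zero.2 hL.1)] at h
  · obtain ⟨C, hC⟩ := QuantizedLinear.exists_preimageCard_le hR hL.1 k
    exact QuantizedLinear.HasAverage.of_tendsto
      ⟨C, fun x => by rw [abs_of_nonneg (Nat.cast_nonneg _)]; exact hC x⟩
      (QuantizedLinear.tendsto_W_preimageCard hR hL k)
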